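/- Consider the Gaussian sequence model $y_j=\theta_j+\sigma\xi_j$, $j=1,\dots,d$, where $\theta=(\theta_1,\dots,\theta_d)\in\mathbb R^d$ is unknown, $\xi_1,\dots,\xi_d$ are i.i.d. standard normal random variables and $\sigma>0$. Let $\mathbf E_\theta$ denote expectation with respect to the law of $(y_1,\dots,y_d)$. Let $L(\theta)=\sum_{i=1}^d\theta_i$, let $B_q(r)=\{\theta\in\mathbb R^d:\ (\sum_{i=1}^d|\theta_i|^q)^{1/q}\le r\}$, and for $\Theta\subseteq\mathbb R^d$ let $$R^*_L(\Theta)=\inf_{\hat T}\sup_{\theta\in\Theta}\mathbf E_\theta\big(\hat T-L(\theta)\big)^2,$$ where the infimum is over all estimators, i.e. all measurable real-valued functions $\hat T$ of $(y_1,\dots,y_d)$. Let $S=\{s\in\mathbb N:\ s\ge 1,\ \sigma^2\log(1+d/s^2)\le r^2s^{-2/q}\}$. Put $m=0$ if $S$ is empty, $m=\max S$ if $S$ is non-empty and bounded, and $m=\infty$ if $S$ is unbounded (for $0<q\le 1$ this happens only if $q=1$ and $r^2\ge\sigma^2d$). Define $$\psi^L_{\sigma,q}(r,d)=\begin{cases}\sigma^2m^2\log(1+d/m^2)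 & \text{if } 1\le m<\infty,\\ r^2 & \text{if } m=0,\\ \sigma^2 d & \text{if } m=\infty.\end{cases}$$ Theorem. Let $0<q\le 1$. There exists a constant $c>0$, depending only on $q$, such that for every integer $d\ge 1$ and all $r,\sigma>0$, $$R^*_L(B_q(r))\ \ge\ c\,\psi^L_{\sigma,q}(r,d).$$ -/

import Mathlib

open MeasureTheory ProbabilityTheory
open scoped ENNReal

namespace SparseMinimax

/-- The law `P_θ` of the observation vector `y = (y_1, …, y_d)` in the Gaussian sequence model
`y_j = θ_j + σ ξ_j`, where `ξ_1, …, ξ_d` are i.i.d. standard normal. -/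
noncomputable def obsLaw {d : ℕ} (σ : ℝ) (θ : Fin d → ℝ) : Measure (Fin d → ℝ) :=
  (Measure.pi (fun _ : Fin d => gaussianReal 0 1)).map (fun ξ j => θ j + σ * ξ j)

/-- The linear functional `L(θ) = ∑ θ_i`. -/
def linFun {d : ℕ} (θ : Fin d → ℝ) : ℝ := ∑ i, θ i

/-- The set `B_q(r) = {θ ∈ ℝ^d : ‖θ‖_q ≤ r}`, where `‖θ‖_q = (∑ |θ_i|^q)^(1/q)`. -/
def lqBall (d : ℕ) (q r : ℝ) : Set (Fin d → ℝ) :=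
  {θ | (∑ i, |θ i| ^ q) ^ (1 / q) ≤ r}

/-- The squared risk `E_θ (est - T(θ))^2` of an estimator `est` of `T(θ)`, with values
in `[0, ∞]`. -/
noncomputable def sqRisk {d : ℕ} (σ : ℝ) (T : (Fin d → ℝ) → ℝ)
    (est : (Fin d → ℝ) → ℝ) (θ : Fin d → ℝ) : ℝ≥0∞ :=
  ∫⁻ y, ENNReal.ofReal ((est y - T θ) ^ 2) ∂(obsLaw σ θ)

/-- The minimax risk `R*_T(Θ)`: infimum over all estimators (measurable functions of the
observation) of the maximum squared risk over `Θ`. -/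
noncomputable def minimaxRisk {d : ℕ} (σ : ℝ) (T : (Fin d → ℝ) → ℝ)
    (Θ : Set (Fin d → ℝ)) : ℝ≥0∞ :=
  ⨅ (est : (Fin d → ℝ) → ℝ) (_ : Measurable est), ⨆ θ ∈ Θ, sqRisk σ T est θ

/-- The set of integers `s ≥ 1` such that `σ² log(1 + d/s²) ≤ r² s^(-2/q)`. -/
def sparsitySet (σ q r : ℝ) (d : ℕ) : Set ℕ :=
  {s | 1 ≤ s ∧ σ ^ 2 * Real.log (1 + (d : ℝ) / (s : ℝ) ^ 2) ≤ r ^ 2 * (s : ℝ) ^ (-2 / q)}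

/-- The effective sparsity `m`: the maximum of `sparsitySet` when that set is non-empty and
bounded, and `0` when it is empty (`sSup ∅ = 0` in `ℕ`). It is only used for bounded sets. -/
noncomputable def effSparsity (σ q r : ℝ) (d : ℕ) : ℕ := sSup (sparsitySet σ q r d)

open Classical in
/-- The rate `ψ^L_{σ,q}(r,d)`: it is `r²` if `m = 0` and `σ² m² log(1 + d/m²)` if `m ≥ 1`.
If `sparsitySet` is unbounded (for `σ, r > 0` and `0 < q ≤ 1` this happens exactly when `q = 1`
and `r² ≥ σ² d`), then it has no maximum, `m = ∞`, and the rate is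
`lim_{m → ∞} σ² m² log(1 + d/m²) = σ² d`. -/
noncomputable def linRate (σ q r : ℝ) (d : ℕ) : ℝ :=
  if BddAbove (sparsitySet σ q r d) then
    if effSparsity σ q r d = 0 then r ^ 2
    else σ ^ 2 * (effSparsity σ q r d : ℝ) ^ 2 *
      Real.log (1 + (d : ℝ) / (effSparsity σ q r d : ℝ) ^ 2)
  else σ ^ 2 * d

end SparseMinimax

/-!
The bound is Le Cam's method with a mixture alternative. The prior puts one spike of height `ρ` at
a uniformly random place in each of `s` blocks of length `b = ⌊d / s⌋`, so that the functional is
`0` at the origin and `s ρ` on the whole support of the prior. Under pure noise the likelihood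
ratio of the mixture has second moment `(1 + (exp (ρ² / σ²) - 1) / b) ^ s`, which stays bounded as
long as `ρ² ≤ σ² log (1 + d / s²)`; no estimator can then beat a multiple of `(s ρ)²`. The vectors
of the prior lie in the ball when `s ^ (1 / q) ρ ≤ r`. Take `s = m` and the largest undetectable
`ρ` if `1 ≤ m ≤ d`. If `m > d`, take `s = d`, which is allowed because `s² log (1 + d / s²)`
increases with `s` while `s² s ^ (-2 / q)` does not; this loses only a constant because
`s² log (1 + d / s²)` never exceeds `d` and is at least `d log 2` at `s = d`. If `m = 0`, a single
spike of height `r` is undetectable.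
-/

namespace SparseMinimax

open scoped NNReal Matrix

section SecondMomentMethod

variable {Ω : Type*} [MeasurableSpace Ω] {P : Measure Ω}

lemma sq_lintegral_mul_le {f g : Ω → ℝ≥0∞} (hf : AEMeasurable f P) (hg : AEMeasurable g P) :
    (∫⁻ x, f x * g x ∂P) ^ 2 ≤ (∫⁻ x, f x ^ 2 ∂P) * ∫⁻ x, g x ^ 2 ∂P := by
  have sq_rpow_half (a : ℝ≥0∞) : (a ^ (1 / 2 : ℝ)) ^ 2 = a := by
    rw [← ENNReal.rpow_natCast, ← ENNReal.rpow_mul]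
    norm_num
  have holder := ENNReal.lintegral_mul_le_Lp_mul_Lq P Real.HolderConjugate.two_two hf hg
  simp only [Pi.mul_apply, ENNReal.rpow_two] at holder
  calc (∫⁻ x, f x * g x ∂P) ^ 2
      ≤ ((∫⁻ x, f x ^ 2 ∂P) ^ (1 / 2 : ℝ) * (∫⁻ x, g x ^ 2 ∂P) ^ (1 / 2 : ℝ)) ^ 2 := by gcongr
    _ = (∫⁻ x, f x ^ 2 ∂P) * ∫⁻ x, g x ^ 2 ∂P := by
      rw [mul_pow, sq_rpow_half, sq_rpow_half]

lemma add_sq_le_of_sq_le {A B K R : ℝ≥0∞} (hA : A ^ 2 ≤ K ^ 2 * R) (hB : B ^ 2 ≤ R) :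
    (A + B) ^ 2 ≤ (1 + K) ^ 2 * R := by
  have hAB : A * B ≤ K * R := by
    refine (ENNReal.pow_le_pow_left_iff two_ne_zero).1 ?_
    calc (A * B) ^ 2 = A ^ 2 * B ^ 2 := mul_pow A B 2
      _ ≤ K ^ 2 * R * R := mul_le_mul' hA hB
      _ = (K * R) ^ 2 := by ring
  calc (A + B) ^ 2 = A ^ 2 + 2 * (A * B) + B ^ 2 := by ring
    _ ≤ K ^ 2 * R + 2 * (K * R) + R := by gcongr
    _ = (1 + K) ^ 2 * R := by ring

variable {E : Type*} [PseudoEMetricSpace E] [MeasurableSpace E] [OpensMeasurableSpace E]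

lemma edist_sq_le_of_density {f : Ω → ℝ≥0∞} (hf : Measurable f) (hf_one : ∫⁻ x, f x ∂P = 1)
    {K R : ℝ≥0∞} (hf_sq : ∫⁻ x, f x ^ 2 ∂P ≤ K ^ 2) {S : Ω → E} (hS : Measurable S) {a b : E}
    (ha : ∫⁻ x, edist (S x) a ^ 2 ∂P ≤ R)
    (hb : ∫⁻ x, edist (S x) b ^ 2 ∂(P.withDensity f) ≤ R) :
    edist a b ^ 2 ≤ (1 + K) ^ 2 * R := by
  set Q := P.withDensity f
  have hQ : ∫⁻ _, 1 ∂Q = 1 := by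
    rw [lintegral_one, withDensity_apply _ .univ, Measure.restrict_univ, hf_one]
  have hSa : Measurable fun x => edist (S x) a := measurable_edist_left.comp hS
  have hSb : Measurable fun x => edist (S x) b := measurable_edist_left.comp hS
  have error_a : (∫⁻ x, edist (S x) a ∂Q) ^ 2 ≤ K ^ 2 * R := by
    rw [lintegral_withDensity_eq_lintegral_mul _ hf hSa]
    exact (sq_lintegral_mul_le hf.aemeasurable hSa.aemeasurable).trans (by gcongr)
  have error_b : (∫⁻ x, edist (S x) b ∂Q) ^ 2 ≤ R := by
    have := sq_lintegral_mul_le (P := Q) hSb.aemeasurable (aemeasurable_const (b := 1))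
    simp only [mul_one, one_pow, hQ] at this
    exact this.trans hb
  have triangle : edist a b ≤ ∫⁻ x, edist (S x) a ∂Q + ∫⁻ x, edist (S x) b ∂Q :=
    calc edist a b = ∫⁻ _, edist a b * 1 ∂Q := by
          rw [lintegral_const_mul _ measurable_const, hQ, mul_one]
      _ ≤ ∫⁻ x, (edist (S x) a + edist (S x) b) ∂Q :=
          lintegral_mono fun x => by rw [mul_one]; exact edist_triangle_left a b (S x)
      _ = _ := lintegral_add_left hSa _
  exact (pow_le_pow_left' triangle 2).trans (add_sq_le_of_sq_le error_a error_b)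

variable {ι : Type*} [Fintype ι] {w : ι → ℝ≥0∞} {f : ι → Ω → ℝ≥0∞}

lemma lintegral_mixture_mul (hf : ∀ i, Measurable (f i)) {g : Ω → ℝ≥0∞} (hg : Measurable g) :
    ∫⁻ x, (∑ i, w i * f i x) * g x ∂P = ∑ i, w i * ∫⁻ x, f i x * g x ∂P := by
  simp only [Finset.sum_mul, mul_assoc]
  rw [lintegral_finsetSum _ fun _ _ => by fun_prop]
  exact Finset.sum_congr rfl fun _ _ => lintegral_const_mul _ (by fun_prop)

lemma edist_sq_le_of_mixture (hw : ∑ i, w i = 1) (hf : ∀ i, Measurable (f i))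
    (hf_one : ∀ i, ∫⁻ x, f i x ∂P = 1) {K R : ℝ≥0∞}
    (hf_mul : ∀ i, ∑ j, w j * ∫⁻ x, f i x * f j x ∂P ≤ K ^ 2)
    {S : Ω → E} (hS : Measurable S) {a b : E} (ha : ∫⁻ x, edist (S x) a ^ 2 ∂P ≤ R)
    (hb : ∀ i, ∫⁻ x, edist (S x) b ^ 2 ∂(P.withDensity (f i)) ≤ R) :
    edist a b ^ 2 ≤ (1 + K) ^ 2 * R := by
  have average_le {c : ι → ℝ≥0∞} {C : ℝ≥0∞} (hc : ∀ i, c i ≤ C) : ∑ i, w i * c i ≤ C :=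
    calc ∑ i, w i * c i ≤ ∑ i, w i * C := Finset.sum_le_sum fun i _ => mul_le_mul_right (hc i) _
      _ = C := by rw [← Finset.sum_mul, hw, one_mul]
  have hfm : Measurable fun x => ∑ i, w i * f i x := by fun_prop
  have hSb : Measurable fun x => edist (S x) b ^ 2 := (measurable_edist_left.comp hS).pow_const 2
  refine edist_sq_le_of_density hfm ?_ ?_ hS ha ?_
  · simpa [hf_one, hw] using lintegral_mixture_mul (P := P) (w := w) hf measurable_one
  · simp only [sq (∑ _, _), lintegral_mixture_mul hf hfm]
    refine average_le fun i => (hf_mul i).trans_eq' ?_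
    simp only [mul_comm (f i _), lintegral_mixture_mul hf (hf i)]
  · rw [lintegral_withDensity_eq_lintegral_mul _ hfm hSb]
    simp only [Pi.mul_apply, lintegral_mixture_mul hf hSb]
    refine average_le fun i => (hb i).trans_eq' ?_
    rw [lintegral_withDensity_eq_lintegral_mul _ (hf i) hSb]
    rfl

end SecondMomentMethod

section GaussianLikelihoodRatio

variable {ι : Type*} [Fintype ι]

lemma pi_withDensity {α : ι → Type*} [∀ i, MeasurableSpace (α i)] {μ : ∀ i, Measure (α i)}
    [∀ i, IsProbabilityMeasure (μ i)] {h : ∀ i, α i → ℝ≥0∞} (hh : ∀ i, Measurable (h i))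
    [∀ i, SigmaFinite ((μ i).withDensity (h i))] :
    Measure.pi (fun i => (μ i).withDensity (h i)) =
      (Measure.pi μ).withDensity fun x => ∏ i, h i (x i) := by
  refine Measure.pi_eq fun s hs => ?_
  have hind (i : ι) : Measurable ((s i).indicator (h i)) := (hh i).indicator (hs i)
  have indicator_prod : (Set.univ.pi s).indicator (fun x => ∏ i, h i (x i)) =
      fun x => ∏ i, (s i).indicator (h i) (x i) := by
    classical
    funext x
    simp only [Set.indicator_apply, Set.mem_univ_pi, Finset.prod_ite_zero, Finset.mem_univ,
      true_imp_iff]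
  calc (Measure.pi μ).withDensity (fun x => ∏ i, h i (x i)) (Set.univ.pi s)
      = ∫⁻ x, ∏ i, (s i).indicator (h i) (x i) ∂(Measure.pi μ) := by
        rw [withDensity_apply _ (.univ_pi hs), ← lintegral_indicator (.univ_pi hs), indicator_prod]
    _ = ∏ i, ∫⁻ x, (s i).indicator (h i) (x i) ∂(Measure.pi μ) :=
        lintegral_prod_eq_prod_lintegral_of_indepFun Finset.univ _
          (iIndepFun_pi fun i => (hind i).aemeasurable)
          fun i => (hind i).comp (measurable_pi_apply i)
    _ = ∏ i, (μ i).withDensity (h i) (s i) := by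
        refine Finset.prod_congr rfl fun i _ => ?_
        rw [withDensity_apply _ (hs i), ← lintegral_indicator (hs i)]
        exact (measurePreserving_eval μ i).lintegral_comp (hind i)

lemma gaussianReal_eq_withDensity {v : ℝ≥0} (hv : v ≠ 0) (m : ℝ) :
    gaussianReal m v = (gaussianReal 0 v).withDensity
      fun x => ENNReal.ofReal (Real.exp ((m * x - m * m / 2) / v)) := by
  rw [gaussianReal_of_var_ne_zero _ hv, gaussianReal_of_var_ne_zero _ hv,
    ← withDensity_mul _ (measurable_gaussianPDF 0 v) (by fun_prop)]
  congr 1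
  funext x
  simp only [Pi.mul_apply, gaussianPDF]
  rw [← ENNReal.ofReal_mul (gaussianPDFReal_nonneg _ _ _)]
  simp only [gaussianPDFReal]
  rw [mul_assoc _ (Real.exp _), ← Real.exp_add]
  congr 3
  field_simp
  ring

/-- The likelihood ratio of the Gaussian vectors `N(θ, v I)` and `N(0, v I)`. -/
noncomputable def gaussianLR (v : ℝ≥0) (θ x : ι → ℝ) : ℝ≥0∞ :=
  ENNReal.ofReal (Real.exp ((θ ⬝ᵥ x - θ ⬝ᵥ θ / 2) / v))

@[fun_prop]
lemma measurable_gaussianLR (v : ℝ≥0) (θ : ι → ℝ) : Measurable (gaussianLR v θ) := by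
  unfold gaussianLR dotProduct
  fun_prop

lemma pi_gaussianReal_eq_withDensity {v : ℝ≥0} (hv : v ≠ 0) (θ : ι → ℝ) :
    Measure.pi (fun i => gaussianReal (θ i) v) =
      (Measure.pi fun _ : ι => gaussianReal 0 v).withDensity (gaussianLR v θ) := by
  have (i : ι) : SigmaFinite ((gaussianReal 0 v).withDensity
      fun x => ENNReal.ofReal (Real.exp ((θ i * x - θ i * θ i / 2) / v))) := by
    rw [← gaussianReal_eq_withDensity hv]
    infer_instance
  simp only [gaussianReal_eq_withDensity hv (θ _)]
  rw [pi_withDensity fun i => by fun_prop]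
  congr 1
  funext x
  rw [← ENNReal.ofReal_prod_of_nonneg fun i _ => (Real.exp_pos _).le, ← Real.exp_sum,
    gaussianLR, ← Finset.sum_div, Finset.sum_sub_distrib, ← Finset.sum_div]
  rfl

lemma lintegral_gaussianLR {v : ℝ≥0} (hv : v ≠ 0) (θ : ι → ℝ) :
    ∫⁻ x, gaussianLR v θ x ∂(Measure.pi fun _ : ι => gaussianReal 0 v) = 1 := by
  rw [← setLIntegral_univ, ← withDensity_apply _ .univ, ← pi_gaussianReal_eq_withDensity hv,
    measure_univ]

lemma gaussianLR_mul (v : ℝ≥0) (θ η x : ι → ℝ) :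
    gaussianLR v θ x * gaussianLR v η x =
      ENNReal.ofReal (Real.exp (θ ⬝ᵥ η / v)) * gaussianLR v (θ + η) x := by
  simp only [gaussianLR]
  rw [← ENNReal.ofReal_mul (Real.exp_pos _).le, ← ENNReal.ofReal_mul (Real.exp_pos _).le,
    ← Real.exp_add, ← Real.exp_add, add_dotProduct, add_dotProduct, dotProduct_add,
    dotProduct_add, dotProduct_comm η θ]
  congr 2
  ring

lemma lintegral_gaussianLR_mul {v : ℝ≥0} (hv : v ≠ 0) (θ η : ι → ℝ) :
    ∫⁻ x, gaussianLR v θ x * gaussianLR v η x ∂(Measure.pi fun _ : ι => gaussianReal 0 v) =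
      ENNReal.ofReal (Real.exp (θ ⬝ᵥ η / v)) := by
  simp only [gaussianLR_mul]
  rw [lintegral_const_mul _ (by fun_prop), lintegral_gaussianLR hv, mul_one]

end GaussianLikelihoodRatio

section MinimaxRisk

variable {d : ℕ} {σ : ℝ}

lemma obsLaw_eq_pi_gaussianReal (σ : ℝ) (θ : Fin d → ℝ) :
    obsLaw σ θ = Measure.pi fun j => gaussianReal (θ j) (.mk (σ ^ 2) (sq_nonneg σ)) := by
  have affine (j : Fin d) : (gaussianReal 0 1).map (fun ξ => θ j + σ * ξ) =
      gaussianReal (θ j) (.mk (σ ^ 2) (sq_nonneg σ)) := by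
    have scale_then_shift : (gaussianReal 0 1).map (fun ξ => θ j + σ * ξ) =
        ((gaussianReal 0 1).map (σ * ·)).map (θ j + ·) :=
      (Measure.map_map (by fun_prop) (by fun_prop)).symm
    rw [scale_then_shift, gaussianReal_map_const_mul, gaussianReal_map_const_add, mul_zero,
      zero_add, mul_one]
  have (j : Fin d) : SigmaFinite ((gaussianReal 0 1).map fun ξ => θ j + σ * ξ) := by
    rw [affine]
    infer_instance
  rw [obsLaw, ← funext affine]
  exact Measure.pi_map_pi (f := fun j ξ => θ j + σ * ξ) fun j => by fun_prop

lemma sqRisk_eq_lintegral_edist (T est : (Fin d → ℝ) → ℝ) (θ : Fin d → ℝ) :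
    sqRisk σ T est θ = ∫⁻ y, edist (est y) (T θ) ^ 2 ∂(obsLaw σ θ) := by
  simp only [sqRisk, edist_dist, Real.dist_eq, ← ENNReal.ofReal_pow (abs_nonneg _), sq_abs]

lemma edist_sq_le_minimaxRisk_of_mixture (hσ : σ ≠ 0) {T : (Fin d → ℝ) → ℝ}
    {Θ : Set (Fin d → ℝ)} (h0 : 0 ∈ Θ) {ι : Type*} [Fintype ι] {w : ι → ℝ≥0∞}
    (hw : ∑ i, w i = 1) {θ : ι → Fin d → ℝ} (hθ : ∀ i, θ i ∈ Θ) {t : ℝ} (hT : ∀ i, T (θ i) = t)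
    {K : ℝ≥0}
    (hK : ∀ i, ∑ j, w j * ENNReal.ofReal (Real.exp (θ i ⬝ᵥ θ j / σ ^ 2)) ≤ K ^ 2) :
    edist (T 0) t ^ 2 ≤ (1 + K) ^ 2 * minimaxRisk σ T Θ := by
  set v : ℝ≥0 := .mk (σ ^ 2) (sq_nonneg σ)
  have hv : v ≠ 0 := fun h => pow_ne_zero 2 hσ (congrArg NNReal.toReal h)
  have hlaw (η : Fin d → ℝ) : obsLaw σ η = (obsLaw σ 0).withDensity (gaussianLR v η) := by
    simp only [obsLaw_eq_pi_gaussianReal, Pi.zero_apply]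
    exact pi_gaussianReal_eq_withDensity hv η
  rw [minimaxRisk, mul_comm, ← ENNReal.div_le_iff (by simp) (by finiteness)]
  refine le_iInf₂ fun est hest => ?_
  rw [ENNReal.div_le_iff (by simp) (by finiteness), mul_comm]
  have risk_le {η : Fin d → ℝ} (hη : η ∈ Θ) :
      ∫⁻ y, edist (est y) (T η) ^ 2 ∂(obsLaw σ η) ≤ ⨆ η ∈ Θ, sqRisk σ T est η := by
    rw [← sqRisk_eq_lintegral_edist]
    exact le_iSup₂ (f := fun η _ => sqRisk σ T est η) η hη
  have hrep : obsLaw σ (0 : Fin d → ℝ) = Measure.pi fun _ => gaussianReal 0 v :=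
    obsLaw_eq_pi_gaussianReal σ 0
  refine edist_sq_le_of_mixture (f := fun i => gaussianLR v (θ i)) hw
    (fun i => measurable_gaussianLR v (θ i)) (fun i => ?_) (fun i => ?_) hest (risk_le h0)
    fun i => ?_
  · rw [hrep, lintegral_gaussianLR hv]
  · simp only [hrep, lintegral_gaussianLR_mul hv]
    exact hK i
  · rw [← hlaw, ← hT i]
    exact risk_le (hθ i)

end MinimaxRisk

section BlockSpikes

variable {κ β ι : Type*}

/-- The vector with entry `ρ` at the positions `e (k, g k)` and `0` elsewhere: the embedding `e`
cuts out disjoint blocks indexed by `κ`, and `g` chooses one coordinate in each block. These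
vectors are the support of the prior in the lower bound. -/
noncomputable def blockSpikes (e : κ × β ↪ ι) (ρ : ℝ) (g : κ → β) : ι → ℝ :=
  Function.extend (fun k => e (k, g k)) (fun _ => ρ) 0

lemma blockSpikes_positions_injective (e : κ × β ↪ ι) (g : κ → β) :
    Function.Injective fun k => e (k, g k) :=
  fun _ _ h => congrArg Prod.fst (e.injective h)

lemma blockSpikes_apply [DecidableEq β] (e : κ × β ↪ ι) (ρ : ℝ) (g : κ → β) (k : κ) (j : β) :
    blockSpikes e ρ g (e (k, j)) = if g k = j then ρ else 0 := by
  split_ifs with h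
  · subst h
    exact (blockSpikes_positions_injective e g).extend_apply _ _ k
  · refine Function.extend_apply' _ _ _ ?_
    rintro ⟨k', hk'⟩
    obtain ⟨rfl, hj⟩ := Prod.mk.inj (e.injective hk')
    exact h hj

lemma blockSpikes_of_notMem_range (e : κ × β ↪ ι) (ρ : ℝ) (g : κ → β) {i : ι}
    (hi : i ∉ Set.range fun k => e (k, g k)) : blockSpikes e ρ g i = 0 :=
  Function.extend_apply' _ _ i hi

variable [Fintype κ] [Fintype ι]

lemma sum_apply_blockSpikes (e : κ × β ↪ ι) (ρ : ℝ) (g : κ → β) {F : ℝ → ℝ} (hF : F 0 = 0) :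
    ∑ i, F (blockSpikes e ρ g i) = Fintype.card κ * F ρ := by
  classical
  rw [← Fintype.sum_of_injective _ (blockSpikes_positions_injective e g) (fun _ => F ρ) _
    (fun i hi => by rw [blockSpikes_of_notMem_range e ρ g hi, hF])
    (fun k => by rw [blockSpikes_apply, if_pos rfl]),
    Finset.sum_const, Finset.card_univ, nsmul_eq_mul]

lemma blockSpikes_dotProduct [DecidableEq β] (e : κ × β ↪ ι) (ρ : ℝ) (g g' : κ → β) :
    blockSpikes e ρ g ⬝ᵥ blockSpikes e ρ g' =
      (Finset.univ.filter fun k => g' k = g k).card * ρ ^ 2 := by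
  rw [dotProduct, ← Fintype.sum_of_injective _ (blockSpikes_positions_injective e g)
    (fun k => if g' k = g k then ρ ^ 2 else 0) _
    (fun i hi => by rw [blockSpikes_of_notMem_range e ρ g hi, zero_mul])
    (fun k => by rw [blockSpikes_apply, if_pos rfl, blockSpikes_apply, mul_ite, mul_zero, sq]),
    ← Finset.sum_filter, Finset.sum_const, nsmul_eq_mul]

lemma sum_pow_card_agreements [DecidableEq κ] [Fintype β] [DecidableEq β] {R : Type*} [CommRing R]
    (x : R) (g : κ → β) :
    ∑ g' : κ → β, x ^ (Finset.univ.filter fun k => g' k = g k).card =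
      (Fintype.card β - 1 + x) ^ Fintype.card κ := by
  have hsum (k : κ) : ∑ j, (if j = g k then x else 1) = Fintype.card β - 1 + x := by
    have hsplit (j : β) : (if j = g k then x else 1) = 1 + if j = g k then x - 1 else 0 := by
      split_ifs <;> ring
    simp only [hsplit, Finset.sum_add_distrib, Finset.sum_ite_eq', Finset.mem_univ, if_true,
      Finset.sum_const, Finset.card_univ, nsmul_eq_mul]
    ring
  calc ∑ g' : κ → β, x ^ (Finset.univ.filter fun k => g' k = g k).card
      = ∑ g' : κ → β, ∏ k, if g' k = g k then x else 1 := by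
        simp only [Finset.prod_ite, Finset.prod_const, one_pow, mul_one]
    _ = ∏ k, ∑ j, (if j = g k then x else 1) :=
        (Fintype.prod_sum fun k j => if j = g k then x else 1).symm
    _ = (Fintype.card β - 1 + x) ^ Fintype.card κ := by
        simp only [hsum, Finset.prod_const, Finset.card_univ]

end BlockSpikes

section UndetectableSpikes

lemma zero_mem_lqBall {d : ℕ} {q r : ℝ} (hq : 0 < q) (hr : 0 ≤ r) :
    (0 : Fin d → ℝ) ∈ lqBall d q r := by
  simp [lqBall, Real.zero_rpow hq.ne', Real.zero_rpow (inv_ne_zero hq.ne'), hr]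

lemma blockSpikes_mem_lqBall {κ β : Type*} [Fintype κ] {d : ℕ}
    (e : κ × β ↪ Fin d) {q r ρ : ℝ} (hq : 0 < q) (hρ : 0 ≤ ρ)
    (hr : (Fintype.card κ : ℝ) ^ (1 / q) * ρ ≤ r) (g : κ → β) :
    blockSpikes e ρ g ∈ lqBall d q r := by
  have hsum := sum_apply_blockSpikes e ρ g (F := fun x => |x| ^ q)
    (by rw [abs_zero, Real.zero_rpow hq.ne'])
  rwa [lqBall, Set.mem_ofPred_eq, hsum, abs_of_nonneg hρ,
    Real.mul_rpow (Nat.cast_nonneg _) (by positivity), ← Real.rpow_mul hρ,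
    mul_one_div_cancel hq.ne', Real.rpow_one]

lemma sub_one_add_pow_le {s : ℕ} (hs : s ≠ 0) {b x : ℝ} (hb : 1 ≤ b) (hx0 : 0 ≤ x)
    (hx : x ≤ 1 + 2 * b / s) : (b - 1 + x) ^ s ≤ 9 * b ^ s := by
  have hbase : b - 1 + x ≤ b * Real.exp (2 / s) :=
    calc b - 1 + x ≤ b * (2 / s + 1) := by
          rw [mul_comm 2 b, mul_div_assoc] at hx
          linarith
      _ ≤ b * Real.exp (2 / s) := by gcongr; exact Real.add_one_le_exp _
  have hexp : Real.exp (2 / s) ^ s ≤ 9 :=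
    calc Real.exp (2 / s) ^ s = Real.exp 1 ^ 2 := by
          rw [← Real.exp_nat_mul, ← Real.exp_nat_mul, mul_div_cancel₀ _ (by positivity)]
          norm_num
      _ ≤ 3 ^ 2 := by gcongr; exact Real.exp_one_lt_three.le
      _ = 9 := by norm_num
  calc (b - 1 + x) ^ s ≤ (b * Real.exp (2 / s)) ^ s := by gcongr
    _ = Real.exp (2 / s) ^ s * b ^ s := by rw [mul_pow, mul_comm]
    _ ≤ 9 * b ^ s := by gcongr

lemma sum_exp_blockSpikes_le {d s : ℕ} (hs : s ≠ 0) (hsd : s ≤ d) {σ ρ : ℝ} (hσ : σ ≠ 0)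
    (hρ : ρ ^ 2 ≤ σ ^ 2 * Real.log (1 + d / s ^ 2)) {ι : Type*} [Fintype ι]
    (e : Fin s × Fin (d / s) ↪ ι) (g : Fin s → Fin (d / s)) :
    ∑ g', Real.exp (blockSpikes e ρ g ⬝ᵥ blockSpikes e ρ g' / σ ^ 2) ≤
      9 * Fintype.card (Fin s → Fin (d / s)) := by
  set b := d / s
  have hb : 1 ≤ b := (Nat.one_le_div_iff (Nat.pos_of_ne_zero hs)).2 hsd
  have hd : d ≤ 2 * b * s := by
    have : d < s * (b + 1) := Nat.lt_mul_div_succ d (Nat.pos_of_ne_zero hs)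
    nlinarith
  have hlr : Real.exp (ρ ^ 2 / σ ^ 2) ≤ 1 + d / s ^ 2 := by
    rw [← Real.le_log_iff_exp_le (by positivity), div_le_iff₀' (by positivity)]
    exact hρ
  have hratio : (d : ℝ) / s ^ 2 ≤ 2 * b / s := by
    rw [div_le_div_iff₀ (by positivity) (by positivity), sq, ← mul_assoc]
    gcongr
    exact_mod_cast hd
  simp only [blockSpikes_dotProduct, mul_div_assoc, Real.exp_nat_mul]
  rw [sum_pow_card_agreements]
  simpa using sub_one_add_pow_le hs (by exact_mod_cast hb) (Real.exp_pos _).le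
    (hlr.trans (by gcongr))

lemma sq_spikes_le_minimaxRisk {d s : ℕ} (hs : s ≠ 0) (hsd : s ≤ d) {σ q r ρ : ℝ} (hσ : σ ≠ 0)
    (hq : 0 < q) (hρ0 : 0 ≤ ρ) (hρ : ρ ^ 2 ≤ σ ^ 2 * Real.log (1 + d / s ^ 2))
    (hr : (s : ℝ) ^ (1 / q) * ρ ≤ r) :
    ENNReal.ofReal ((s * ρ) ^ 2) ≤ 16 * minimaxRisk σ linFun (lqBall d q r) := by
  let e : Fin s × Fin (d / s) ↪ Fin d :=
    finProdFinEquiv.toEmbedding.trans (Fin.castLEEmb (Nat.mul_div_le d s))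
  have hblock : Nonempty (Fin (d / s)) :=
    ⟨⟨0, Nat.div_pos hsd (Nat.pos_of_ne_zero hs)⟩⟩
  let N : ℝ≥0∞ := Fintype.card (Fin s → Fin (d / s))
  have hN0 : N ≠ 0 := Nat.cast_ne_zero.2 Fintype.card_ne_zero
  have hNtop : N ≠ ⊤ := ENNReal.natCast_ne_top _
  have h := edist_sq_le_minimaxRisk_of_mixture (T := linFun) (w := fun _ => N⁻¹) (K := 3)
    (t := s * ρ) hσ (zero_mem_lqBall hq (hr.trans' (by positivity)))
    (by rw [Finset.sum_const, Finset.card_univ, nsmul_eq_mul, ENNReal.mul_inv_cancel hN0 hNtop])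
    (blockSpikes_mem_lqBall e hq hρ0 (by simpa using hr))
    (fun g => by simpa [linFun] using sum_apply_blockSpikes e ρ g (F := id) rfl)
    fun g => by
      rw [← Finset.mul_sum, ENNReal.inv_mul_le_iff hN0 hNtop,
        ← ENNReal.ofReal_sum_of_nonneg fun _ _ => (Real.exp_pos _).le]
      refine (ENNReal.ofReal_le_ofReal (sum_exp_blockSpikes_le hs hsd hσ hρ e g)).trans_eq ?_
      rw [ENNReal.ofReal_mul (by norm_num), ENNReal.ofReal_natCast, mul_comm]
      norm_num [N]
  have hdist : edist (linFun (0 : Fin d → ℝ)) (s * ρ) ^ 2 = ENNReal.ofReal ((s * ρ) ^ 2) := by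
    rw [edist_dist, ← ENNReal.ofReal_pow dist_nonneg, Real.dist_eq, sq_abs]
    simp [linFun]
  rw [← hdist]
  exact h.trans_eq (by norm_num)

end UndetectableSpikes

section Rate

variable {d : ℕ} {σ q r : ℝ}

lemma mul_log_one_add_div_le_mul {x a b : ℝ} (hx : 0 ≤ x) (ha : 0 < a) (hab : a ≤ b) :
    a * Real.log (1 + x / a) ≤ b * Real.log (1 + x / b) := by
  have hb : 0 < b := ha.trans_le hab
  have hnonneg : 0 ≤ x / b := by positivity
  have bernoulli : 1 + x / a ≤ (1 + x / b) ^ (b / a) := by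
    convert one_add_mul_self_le_rpow_one_add (by linarith : -1 ≤ x / b)
      ((one_le_div ha).2 hab) using 2
    field_simp
  calc a * Real.log (1 + x / a) ≤ a * Real.log ((1 + x / b) ^ (b / a)) := by gcongr
    _ = b * Real.log (1 + x / b) := by
      rw [Real.log_rpow (by positivity), ← mul_assoc, mul_div_cancel₀ _ ha.ne']

lemma mul_log_one_add_div_le {x b : ℝ} (hx : 0 ≤ x) (hb : 0 < b) :
    b * Real.log (1 + x / b) ≤ x :=
  calc b * Real.log (1 + x / b) ≤ b * (x / b) := by
        gcongr
        linarith [Real.log_le_sub_one_of_pos (by positivity : 0 < 1 + x / b)]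
    _ = x := mul_div_cancel₀ x hb.ne'

lemma mem_sparsitySet_of_le (hq0 : 0 < q) (hq1 : q ≤ 1) {s m : ℕ} (hs : 1 ≤ s) (hsm : s ≤ m)
    (hm : m ∈ sparsitySet σ q r d) : s ∈ sparsitySet σ q r d := by
  have hs0 : (0 : ℝ) < s := by exact_mod_cast hs
  have hm0 : (0 : ℝ) < m := by exact_mod_cast hm.1
  have hexponent : 2 + -2 / q ≤ 0 := by
    have : 2 ≤ 2 / q := by rw [le_div_iff₀ hq0]; linarith
    rw [neg_div]
    linarith
  have sq_mul_rpow {x : ℝ} (hx : 0 < x) : x ^ 2 * x ^ (-2 / q) = x ^ (2 + -2 / q) := by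
    rw [Real.rpow_add hx, Real.rpow_two]
  refine ⟨hs, le_of_mul_le_mul_left ?_ (pow_pos hs0 2)⟩
  calc (s : ℝ) ^ 2 * (σ ^ 2 * Real.log (1 + d / s ^ 2))
      = σ ^ 2 * (s ^ 2 * Real.log (1 + d / s ^ 2)) := by ring
    _ ≤ σ ^ 2 * (m ^ 2 * Real.log (1 + d / m ^ 2)) := by
        gcongr σ ^ 2 * ?_
        exact mul_log_one_add_div_le_mul d.cast_nonneg (by positivity) (by gcongr)
    _ = m ^ 2 * (σ ^ 2 * Real.log (1 + d / m ^ 2)) := by ring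
    _ ≤ m ^ 2 * (r ^ 2 * m ^ (-2 / q)) := mul_le_mul_of_nonneg_left hm.2 (sq_nonneg _)
    _ = r ^ 2 * (m : ℝ) ^ (2 + -2 / q) := by rw [← sq_mul_rpow hm0]; ring
    _ ≤ r ^ 2 * (s : ℝ) ^ (2 + -2 / q) := by
        gcongr r ^ 2 * ?_
        exact Real.rpow_le_rpow_of_nonpos hs0 (by exact_mod_cast hsm) hexponent
    _ = s ^ 2 * (r ^ 2 * s ^ (-2 / q)) := by rw [← sq_mul_rpow hs0]; ring

lemma rpow_mul_le_of_sq_le {s ρ : ℝ} (hs : 0 < s) (hr : 0 ≤ r)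
    (hρ : ρ ^ 2 ≤ r ^ 2 * s ^ (-2 / q)) : s ^ (1 / q) * ρ ≤ r := by
  refine le_of_sq_le_sq ?_ hr
  calc (s ^ (1 / q) * ρ) ^ 2 = s ^ (2 / q) * ρ ^ 2 := by
        rw [mul_pow, ← Real.rpow_mul_natCast hs.le]
        congr 2
        push_cast
        ring
    _ ≤ s ^ (2 / q) * (r ^ 2 * s ^ (-2 / q)) := by gcongr
    _ = r ^ 2 := by
        rw [mul_left_comm, ← Real.rpow_add hs, neg_div, add_neg_cancel, Real.rpow_zero, mul_one]

lemma le_minimaxRisk_of_mem_sparsitySet_of_le (hσ : σ ≠ 0) (hq : 0 < q) (hr : 0 ≤ r) {s : ℕ}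
    (hsd : s ≤ d) (hs : s ∈ sparsitySet σ q r d) :
    ENNReal.ofReal (σ ^ 2 * s ^ 2 * Real.log (1 + d / s ^ 2)) ≤
      16 * minimaxRisk σ linFun (lqBall d q r) := by
  have hs0 : s ≠ 0 := Nat.one_le_iff_ne_zero.1 hs.1
  have hlog : 0 ≤ Real.log (1 + d / (s : ℝ) ^ 2) :=
    Real.log_nonneg (le_add_of_nonneg_right (by positivity))
  have hheight := Real.sq_sqrt (mul_nonneg (sq_nonneg σ) hlog)
  convert sq_spikes_le_minimaxRisk hs0 hsd hσ hq (Real.sqrt_nonneg _) hheight.le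
    (rpow_mul_le_of_sq_le (by positivity) hr (hheight.trans_le hs.2)) using 2
  rw [mul_pow, hheight]
  ring

lemma sq_mul_dim_le_minimaxRisk (hσ : σ ≠ 0) (hq0 : 0 < q) (hq1 : q ≤ 1) (hr : 0 ≤ r) {m : ℕ}
    (hd : 1 ≤ d) (hdm : d ≤ m) (hm : m ∈ sparsitySet σ q r d) :
    ENNReal.ofReal (σ ^ 2 * d) ≤ 32 * minimaxRisk σ linFun (lqBall d q r) := by
  have hd1 : (1 : ℝ) ≤ d := by exact_mod_cast hd
  have hlog : (d : ℝ) ≤ 2 * (d ^ 2 * Real.log (1 + d / d ^ 2)) :=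
    calc (d : ℝ) ≤ 2 * (d * Real.log (1 + d / d)) := by
          rw [div_self (by positivity), one_add_one_eq_two]
          nlinarith [Real.log_two_gt_d9]
      _ ≤ 2 * (d ^ 2 * Real.log (1 + d / d ^ 2)) := by
          gcongr 2 * ?_
          exact mul_log_one_add_div_le_mul d.cast_nonneg (by positivity) (by nlinarith)
  calc ENNReal.ofReal (σ ^ 2 * d)
      ≤ ENNReal.ofReal (2 * (σ ^ 2 * d ^ 2 * Real.log (1 + d / d ^ 2))) := by
        refine ENNReal.ofReal_le_ofReal ?_
        nlinarith [sq_nonneg σ]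
    _ = 2 * ENNReal.ofReal (σ ^ 2 * d ^ 2 * Real.log (1 + d / d ^ 2)) := by
        rw [ENNReal.ofReal_mul zero_le_two, ENNReal.ofReal_ofNat]
    _ ≤ 2 * (16 * minimaxRisk σ linFun (lqBall d q r)) := by
        gcongr
        exact le_minimaxRisk_of_mem_sparsitySet_of_le hσ hq0 hr le_rfl
          (mem_sparsitySet_of_le hq0 hq1 hd hdm hm)
    _ = 32 * minimaxRisk σ linFun (lqBall d q r) := by
        rw [← mul_assoc]
        norm_num

lemma le_minimaxRisk_of_mem_sparsitySet (hσ : σ ≠ 0) (hq0 : 0 < q) (hq1 : q ≤ 1) (hr : 0 ≤ r)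
    {m : ℕ} (hd : 1 ≤ d) (hm : m ∈ sparsitySet σ q r d) :
    ENNReal.ofReal (σ ^ 2 * m ^ 2 * Real.log (1 + d / m ^ 2)) ≤
      32 * minimaxRisk σ linFun (lqBall d q r) := by
  rcases le_total m d with hmd | hdm
  · refine (le_minimaxRisk_of_mem_sparsitySet_of_le hσ hq0 hr hmd hm).trans ?_
    gcongr
    norm_num
  · have hm0 : (0 : ℝ) < m := by exact_mod_cast hm.1
    refine (ENNReal.ofReal_le_ofReal ?_).trans
      (sq_mul_dim_le_minimaxRisk hσ hq0 hq1 hr hd hdm hm)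
    rw [mul_assoc]
    gcongr
    exact mul_log_one_add_div_le d.cast_nonneg (by positivity)

lemma sq_radius_le_minimaxRisk (hσ : σ ≠ 0) (hq : 0 < q) (hr : 0 ≤ r) (hd : 1 ≤ d)
    (h1 : 1 ∉ sparsitySet σ q r d) :
    ENNReal.ofReal (r ^ 2) ≤ 16 * minimaxRisk σ linFun (lqBall d q r) := by
  have hundetectable : r ^ 2 ≤ σ ^ 2 * Real.log (1 + d / (1 : ℕ) ^ 2) := by
    by_contra! hlt
    exact h1 ⟨le_rfl, by simpa using hlt.le⟩
  simpa using sq_spikes_le_minimaxRisk one_ne_zero hd hσ hq hr hundetectable (by simp)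

lemma effSparsity_mem_sparsitySet (hbdd : BddAbove (sparsitySet σ q r d))
    (hzero : effSparsity σ q r d ≠ 0) : effSparsity σ q r d ∈ sparsitySet σ q r d :=
  Nat.sSup_mem (Set.nonempty_iff_ne_empty.2 fun hempty => hzero <| by
    rw [effSparsity, hempty, csSup_empty, Nat.bot_eq_zero]) hbdd

lemma one_notMem_sparsitySet (hbdd : BddAbove (sparsitySet σ q r d))
    (hzero : effSparsity σ q r d = 0) : 1 ∉ sparsitySet σ q r d :=
  fun h1 => one_ne_zero (Nat.le_zero.1 ((le_csSup hbdd h1).trans_eq hzero))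

end Rate

end SparseMinimax

open SparseMinimax in
theorem theorem2_general {q r σ : ℝ} {d : ℕ} (hq0 : 0 < q) (hq1 : q ≤ 1) (hd : 1 ≤ d)
    (hr : 0 ≤ r) (hσ : σ ≠ 0) :
    ENNReal.ofReal (linRate σ q r d) ≤ 32 * minimaxRisk σ linFun (lqBall d q r) := by
  unfold linRate
  split_ifs with hbdd hzero
  · refine (sq_radius_le_minimaxRisk hσ hq0 hr hd (one_notMem_sparsitySet hbdd hzero)).trans ?_
    gcongr
    norm_num
  · exact le_minimaxRisk_of_mem_sparsitySet hσ hq0 hq1 hr hd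
      (effSparsity_mem_sparsitySet hbdd hzero)
  · obtain ⟨m, hm, hdm⟩ := not_bddAbove_iff.1 hbdd d
    exact sq_mul_dim_le_minimaxRisk hσ hq0 hq1 hr hd hdm.le hm

theorem theorem2 (q : ℝ) (hq0 : 0 < q) (hq1 : q ≤ 1) :
    ∃ c : ℝ, 0 < c ∧ ∀ d : ℕ, 1 ≤ d → ∀ r σ : ℝ, 0 < r → 0 < σ →
      ENNReal.ofReal (c * SparseMinimax.linRate σ q r d) ≤
        SparseMinimax.minimaxRisk σ SparseMinimax.linFun (SparseMinimax.lqBall d q r) := by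
  refine ⟨1 / 32, by norm_num, fun d hd r σ hr hσ => ?_⟩
  rw [one_div_mul_eq_div, ENNReal.ofReal_div_of_pos (by norm_num), ENNReal.ofReal_ofNat]
  exact ENNReal.div_le_of_le_mul' (theorem2_general hq0 hq1 hd hr.le hσ.ne')
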